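/- Let $\mathbb{D}$ be the open unit disk and let $H^2$ be the Hardy space of analytic functions $f(z)=\sum_{n\ge 0}a_nz^n$ on $\mathbb{D}$ with $\|f\|^2=\sum_n|a_n|^2<\infty$. For $w\in\mathbb{D}$ put $K_w(z)=\frac{1}{1-\bar w z}$. For $\psi:\mathbb{D}\to\mathbb{C}$ and $\varphi:\mathbb{D}\to\mathbb{D}$ analytic, $W_{\psi,\varphi}$ denotes the weighted composition operator $W_{\psi,\varphi}f=\psi\cdot(f\circ\varphi)$ on $H^2$. A conjugation on a complex Hilbert space is a conjugate-linear map $C$ with $\langle Cx,Cy\rangle=\langle y,x\rangle$ for all $x,y$ and $C^2=I$; for a conjugation $C$, a bounded operator $T$ is called $C$-normal if $CT^*TC=TT^*$. Let $(Jf)(z)=\overline{f(\bar z)}$. Let $p\in\mathbb{D}\setminus\{0\}$, let $\lambda$ be the unimodular number with $\lambda p=\bar p$, and put $$\xi_p(z)=\frac{\sqrt{1-|p|^2}}{1-\bar p z},\qquad \tau_p(z)=\frac{\lambda(p-z)}{1-\bar p z}.$$ Let $\varphi(z)=\frac{az+b}{cz+d}$ ($a,b,c,d\in\mathbb{C}$,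 $ad-bc\neq 0$) be a linear fractional self-map of $\mathbb{D}$, let $\sigma(z)=\frac{\bar a z-\bar c}{-\bar b z+\bar d}$, and let $\psi=\beta K_{\sigma(0)}$ with a constant $\beta\neq 0$. Then $W_{\psi,\varphi}$ and $W_{\xi_p,\tau_p}$ are bounded operators on $H^2$, $JW_{\xi_p,\tau_p}$ is a conjugation, and $W_{\psi,\varphi}$ is $JW_{\xi_p,\tau_p}$-normal if and only if $$(|b|^2-|c|^2)\,p=(-\bar a c+\bar b d-a\bar b+c\bar d)\,|p|^2$$ and $$(|a|^2-|d|^2)\,|p|^2=(\bar a c-\bar b d)\,\bar p-(\bar a b-\bar c d)\,p.$$ -/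

import Mathlib

open Complex
open scoped ComplexConjugate InnerProductSpace Complex.UnitDisc

noncomputable section

/-! ### The Hardy space `H²` of the unit disc -/

/-- The Taylor coefficients of a function given on the disc by a power series are unique. -/
theorem taylorCoeff_unique {a b : ℕ → ℂ} {f : 𝔻 → ℂ}
    (ha : ∀ z : 𝔻, HasSum (fun n => a n * (z : ℂ) ^ n) (f z))
    (hb : ∀ z : 𝔻, HasSum (fun n => b n * (z : ℂ) ^ n) (f z)) : a = b := by
  have h0 : ∀ᶠ z in nhds (0 : ℂ),
      HasSum (fun n => z ^ n • (FormalMultilinearSeries.ofScalars ℂ (a - b)).coeff n)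
        ((fun _ : ℂ => (0 : ℂ)) (0 + z)) := by
    filter_upwards [Metric.ball_mem_nhds (0 : ℂ) one_pos] with z hz
    have hz' : ‖z‖ < 1 := by simpa using hz
    have h1 := (ha (UnitDisc.mk z hz')).sub (hb (UnitDisc.mk z hz'))
    simp only [sub_self, UnitDisc.coe_mk] at h1
    refine Eq.mp (congrArg (fun u => HasSum u (0 : ℂ)) ?_) h1
    funext n
    rw [FormalMultilinearSeries.coeff_ofScalars, Pi.sub_apply, smul_eq_mul]
    ring
  have h2 := (hasFPowerSeriesAt_iff (z₀ := (0 : ℂ)).2 h0).eq_zero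
  funext n
  have h3 := congrArg (fun p => FormalMultilinearSeries.coeff p n) h2
  simp only [FormalMultilinearSeries.coeff_ofScalars, Pi.sub_apply] at h3
  refine sub_eq_zero.1 (h3.trans ?_)
  simp [FormalMultilinearSeries.coeff]

/-- The space of functions `f` on the unit disc of the form `f z = ∑ aₙ zⁿ` (so that `f` is
analytic) with `∑ |aₙ|² < ∞`. -/
def hardySubmodule : Submodule ℂ (𝔻 → ℂ) where
  carrier := {f | ∃ a : lp (fun _ : ℕ => ℂ) 2, ∀ z : 𝔻, HasSum (fun n => a n * (z : ℂ) ^ n) (f z)}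
  zero_mem' := ⟨0, fun z => by simp⟩
  add_mem' := by
    rintro f g ⟨a, ha⟩ ⟨b, hb⟩
    refine ⟨a + b, fun z => ?_⟩
    simpa [add_mul] using (ha z).add (hb z)
  smul_mem' := by
    rintro k f ⟨a, ha⟩
    refine ⟨k • a, fun z => ?_⟩
    simpa [mul_assoc] using (ha z).mul_left k

/-- The square-summability of the coefficients, written out. -/
theorem mem_hardySubmodule_iff (f : 𝔻 → ℂ) :
    f ∈ hardySubmodule ↔ ∃ a : ℕ → ℂ, Summable (fun n => ‖a n‖ ^ 2) ∧
      ∀ z : 𝔻, HasSum (fun n => a n * (z : ℂ) ^ n) (f z) := by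
  constructor
  · rintro ⟨a, ha⟩
    refine ⟨a, ?_, ha⟩
    have := (memℓp_gen_iff (p := 2) (by norm_num)).1 (lp.memℓp a)
    simpa using this
  · rintro ⟨a, hs, ha⟩
    refine ⟨⟨a, (memℓp_gen_iff (p := 2) (by norm_num)).2 (by simpa using hs)⟩, ha⟩

/-- The Hardy space `H²(𝔻)`. -/
def HardySpace : Type := hardySubmodule

namespace HardySpace

instance : AddCommGroup HardySpace := inferInstanceAs (AddCommGroup hardySubmodule)

instance : Module ℂ HardySpace := inferInstanceAs (Module ℂ hardySubmodule)

instance : FunLike HardySpace 𝔻 ℂ where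
  coe f := f.1
  coe_injective _ _ h := Subtype.ext h

@[ext]
theorem ext {f g : HardySpace} (h : ∀ z, f z = g z) : f = g := DFunLike.ext f g h

@[simp]
theorem add_apply (f g : HardySpace) (z : 𝔻) : (f + g) z = f z + g z := rfl

@[simp]
theorem smul_apply (k : ℂ) (f : HardySpace) (z : 𝔻) : (k • f) z = k * f z := rfl

/-- The sequence of Taylor coefficients of `f ∈ H²`. -/
def coeff (f : HardySpace) : lp (fun _ : ℕ => ℂ) 2 := f.2.choose

theorem hasSum_coeff (f : HardySpace) (z : 𝔻) :
    HasSum (fun n => f.coeff n * (z : ℂ) ^ n) (f z) := f.2.choose_spec z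

theorem coeff_eq_of_hasSum {f : HardySpace} {a : lp (fun _ : ℕ => ℂ) 2}
    (h : ∀ z : 𝔻, HasSum (fun n => a n * (z : ℂ) ^ n) (f z)) : f.coeff = a :=
  lp.ext (taylorCoeff_unique f.hasSum_coeff h)

theorem summable_power (a : lp (fun _ : ℕ => ℂ) 2) (z : 𝔻) :
    Summable (fun n => a n * (z : ℂ) ^ n) := by
  refine Summable.of_norm_bounded (g := fun n => ‖a‖ * ‖(z : ℂ)‖ ^ n)
    ((summable_geometric_of_lt_one (norm_nonneg _) z.norm_lt_one).mul_left _) fun n => ?_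
  rw [norm_mul, norm_pow]
  gcongr
  exact lp.norm_apply_le_norm (by norm_num) a n

/-- Taking Taylor coefficients identifies `H²` with `ℓ²`. -/
def coeffEquiv : HardySpace ≃ₗ[ℂ] lp (fun _ : ℕ => ℂ) 2 where
  toFun := coeff
  map_add' f g := coeff_eq_of_hasSum fun z => by
    simpa [add_mul] using (f.hasSum_coeff z).add (g.hasSum_coeff z)
  map_smul' k f := coeff_eq_of_hasSum fun z => by
    simpa [mul_assoc] using (f.hasSum_coeff z).mul_left k
  invFun a := ⟨fun z => ∑' n, a n * (z : ℂ) ^ n, a, fun z => (summable_power a z).hasSum⟩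
  left_inv f := ext fun z => (f.hasSum_coeff z).tsum_eq
  right_inv a := coeff_eq_of_hasSum fun z => (summable_power a z).hasSum

/-- The norm of `f ∈ H²` is the `ℓ²`-norm of its Taylor coefficients. -/
instance : NormedAddCommGroup HardySpace :=
  NormedAddCommGroup.induced HardySpace (lp (fun _ : ℕ => ℂ) 2) coeffEquiv coeffEquiv.injective

theorem norm_def (f : HardySpace) : ‖f‖ = ‖f.coeff‖ := rfl

theorem norm_sq_eq (f : HardySpace) : ‖f‖ ^ 2 = ∑' n, ‖f.coeff n‖ ^ 2 := by
  have := lp.norm_rpow_eq_tsum (p := 2) (by norm_num) f.coeff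
  simpa [norm_def] using this

instance : NormedSpace ℂ HardySpace where
  norm_smul_le k f := by
    have h : (k • f).coeff = k • f.coeff := coeffEquiv.map_smul k f
    rw [norm_def, h, norm_smul, norm_def]

/-- The inner product `⟪f, g⟫ = ∑ conj aₙ * bₙ` of `f = ∑ aₙ zⁿ` and `g = ∑ bₙ zⁿ`
(conjugate-linear in the first variable). -/
instance : InnerProductSpace ℂ HardySpace where
  inner f g := ⟪f.coeff, g.coeff⟫_ℂ
  norm_sq_eq_re_inner f := by rw [norm_def]; exact norm_sq_eq_re_inner (𝕜 := ℂ) f.coeff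
  conj_inner_symm f g := inner_conj_symm f.coeff g.coeff
  add_left f g h := by
    change ⟪coeffEquiv (f + g), _⟫_ℂ = _
    rw [map_add]; exact inner_add_left _ _ _
  smul_left f g k := by
    change ⟪coeffEquiv (k • f), _⟫_ℂ = _
    rw [map_smul]; exact inner_smul_left _ _ _

theorem inner_def (f g : HardySpace) : ⟪f, g⟫_ℂ = ⟪f.coeff, g.coeff⟫_ℂ := rfl

/-- The identification with `ℓ²` is isometric. -/
def coeffIsometry : HardySpace ≃ₗᵢ[ℂ] lp (fun _ : ℕ => ℂ) 2 where
  toLinearEquiv := coeffEquiv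
  norm_map' _ := rfl

instance : CompleteSpace HardySpace :=
  coeffIsometry.toIsometryEquiv.completeSpace

theorem conj_mem (f : HardySpace) : (fun z : 𝔻 => conj (f (star z))) ∈ hardySubmodule := by
  rw [mem_hardySubmodule_iff]
  obtain ⟨a, hs, ha⟩ := (mem_hardySubmodule_iff f).1 f.2
  refine ⟨fun n => conj (a n), by simpa using hs, fun z => ?_⟩
  have := (Complex.hasSum_conj'.2 (ha (star z)))
  simpa using this

/-- The conjugate-linear operator `(J f)(z) = conj (f (conj z))` on `H²`. -/
def J : HardySpace →ₗ⋆[ℂ] HardySpace where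
  toFun f := ⟨fun z => conj (f (star z)), conj_mem f⟩
  map_add' f g := ext fun z => map_add conj (f (star z)) (g (star z))
  map_smul' k f := ext fun z => map_mul conj k (f (star z))

@[simp]
theorem J_apply (f : HardySpace) (z : 𝔻) : J f z = conj (f (star z)) := rfl

end HardySpace

/-- `T` is the (bounded) weighted composition operator `W_{ψ,φ}` on `H²`:
`(T f)(z) = ψ(z) f(φ(z))`. -/
def IsWeightedComposition (ψ : 𝔻 → ℂ) (φ : 𝔻 → 𝔻) (T : HardySpace →L[ℂ] HardySpace) : Prop :=
  ∀ (f : HardySpace) (z : 𝔻), T f z = ψ z * f (φ z)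

/-! ### Conjugations and `C`-normal operators -/

section Conjugation

variable {H : Type*} [NormedAddCommGroup H] [InnerProductSpace ℂ H]

/-- A conjugation on `H`: a conjugate-linear isometric involution. -/
def IsConjugation (C : H →ₗ⋆[ℂ] H) : Prop :=
  (∀ x y : H, ⟪C x, C y⟫_ℂ = ⟪y, x⟫_ℂ) ∧ ∀ x : H, C (C x) = x

/-- For a conjugation `C`, the bounded operator `T` is `C`-normal: `C T* T C = T T*`. -/
def IsCNormal [CompleteSpace H] (C : H →ₗ⋆[ℂ] H) (T : H →L[ℂ] H) : Prop :=
  ∀ x : H, C (T.adjoint (T (C x))) = T (T.adjoint x)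

end Conjugation

/-! ### The symbols -/

/-- The function `K_w(z) = 1 / (1 - conj w * z)`, the reproducing kernel of `H²` at `w`
when `|w| < 1`. -/
def kernelFun (w : ℂ) (z : 𝔻) : ℂ := 1 / (1 - conj w * z)

/-- `z ↦ (a z + b) / (c z + d)` is a (nondegenerate) linear fractional self-map of the disc. -/
structure IsLinearFractionalSelfMap (a b c d : ℂ) : Prop where
  det_ne_zero : a * d - b * c ≠ 0
  denom_ne_zero : ∀ z : 𝔻, c * z + d ≠ 0
  norm_lt_one : ∀ z : 𝔻, ‖(a * z + b) / (c * z + d)‖ < 1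

/-- The self-map `φ(z) = (a z + b) / (c z + d)` of the disc. -/
def linFrac {a b c d : ℂ} (h : IsLinearFractionalSelfMap a b c d) (z : 𝔻) : 𝔻 :=
  UnitDisc.mk ((a * z + b) / (c * z + d)) (h.norm_lt_one z)

/-- `σ(z) = (conj a * z - conj c) / (-conj b * z + conj d)`. -/
def sigmaFun (a b c d z : ℂ) : ℂ := (conj a * z - conj c) / (-conj b * z + conj d)

/-- `ξ_p(z) = √(1 - |p|²) / (1 - conj p * z)`. -/
def xi (p : 𝔻) (z : 𝔻) : ℂ := (Real.sqrt (1 - ‖(p : ℂ)‖ ^ 2) : ℂ) / (1 - conj (p : ℂ) * z)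

theorem norm_tau_lt_one (lam : Circle) (p z : 𝔻) :
    ‖(lam : ℂ) * ((p : ℂ) - z) / (1 - conj (p : ℂ) * z)‖ < 1 := by
  have hp := p.normSq_lt_one
  have hz := z.normSq_lt_one
  have key : normSq (1 - conj (p : ℂ) * z) - normSq ((p : ℂ) - z)
      = (1 - normSq (p : ℂ)) * (1 - normSq (z : ℂ)) := by
    simp only [normSq_apply, sub_re, sub_im, mul_re, mul_im, conj_re, conj_im, one_re, one_im]
    ring
  have hlt : normSq ((p : ℂ) - z) < normSq (1 - conj (p : ℂ) * z) := by
    have := mul_pos (sub_pos.2 hp) (sub_pos.2 hz)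
    linarith
  have hpos : 0 < ‖1 - conj (p : ℂ) * z‖ := by
    rw [norm_pos_iff, ← normSq_pos]
    exact (normSq_nonneg _).trans_lt hlt
  rw [norm_div, norm_mul, Circle.norm_coe, one_mul, div_lt_one hpos]
  rw [normSq_eq_norm_sq, normSq_eq_norm_sq] at hlt
  exact lt_of_pow_lt_pow_left₀ 2 hpos.le hlt

/-- The disc automorphism `τ_p(z) = λ (p - z) / (1 - conj p * z)`, `|λ| = 1`. -/
def tau (lam : Circle) (p : 𝔻) (z : 𝔻) : 𝔻 :=
  UnitDisc.mk ((lam : ℂ) * ((p : ℂ) - z) / (1 - conj (p : ℂ) * z)) (norm_tau_lt_one lam p z)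

end

noncomputable section

/-! Write `C = J V`, where `V` is the operator with symbols `xi p`, `tau lam p`. Since `T T*` and `C
T* T C` are both self-adjoint, `C`-normality is an identity between their values on reproducing
kernels (`isCNormal_iff_kernel`). The weight is `β d / (c z + d)`, so its pole cancels that of the
linear fractional map, and functions `1 / (e - f z)` stay in this class, up to scalars, under `T`,
`T*` and `C`. Hence both values are explicit: a constant over a polynomial of degree at most one in
`z` and in `conj w` (`J_comp_adjoint_comp_kernel`, `IsWeightedComposition.inner_comp_adjoint`).
Normality says that the two denominators agree up to the factor `1 - |p|²`, and comparing
coefficients leaves exactly the two stated equations (`kernel_identity_iff`).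

Boundedness is the positivity of `M² K - K_W`, where `K` is the reproducing kernel and `K_W` is the
kernel of `W W*` (`exists_isWeightedComposition`). For `V` the difference is zero with `M = 1`. For
`W` it follows from a decomposition of `|c z + d|² - |a z + b|²` (`exists_form_eq`). -/

theorem memlp_two_iff (a : ℕ → ℂ) :
    Memℓp a 2 ↔ Summable (fun n => ‖a n‖ ^ 2) := by
  rw [memℓp_gen_iff (by norm_num)]
  simp

theorem Complex.UnitDisc.norm_conj_mul_lt_one (w z : 𝔻) : ‖conj (w : ℂ) * z‖ < 1 := by
  rw [norm_mul, RCLike.norm_conj]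
  exact mul_lt_one_of_nonneg_of_lt_one_left (norm_nonneg _) w.norm_lt_one z.norm_lt_one.le

theorem Complex.UnitDisc.one_sub_conj_mul_ne_zero (w z : 𝔻) : 1 - conj (w : ℂ) * z ≠ 0 := by
  intro h
  have := UnitDisc.norm_conj_mul_lt_one w z
  rw [← sub_eq_zero.1 h, norm_one] at this
  exact lt_irrefl _ this

/-! ### Reproducing kernels of `H²` and the action of `J` on coefficients. -/

namespace HardySpace

/-- The sequence `n ↦ conj w ^ n` of Taylor coefficients of the reproducing kernel at `w`. -/
def kernelCoeff (w : 𝔻) : lp (fun _ : ℕ => ℂ) 2 :=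
  ⟨fun n => conj (w : ℂ) ^ n, (memlp_two_iff _).2 <| by
    have := summable_geometric_of_lt_one (sq_nonneg ‖(w : ℂ)‖) w.sq_norm_lt_one
    refine this.congr fun n => ?_
    rw [norm_pow, RCLike.norm_conj, ← pow_mul, ← pow_mul, mul_comm]⟩

/-- The reproducing kernel of `H²` at `w`. -/
def kernel (w : 𝔻) : HardySpace := coeffEquiv.symm (kernelCoeff w)

theorem coeff_kernel (w : 𝔻) : (kernel w).coeff = kernelCoeff w :=
  coeffEquiv.apply_symm_apply _

theorem hasSum_kernel (w z : 𝔻) :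
    HasSum (fun n => (z : ℂ) ^ n * conj (w : ℂ) ^ n) (1 / (1 - conj (w : ℂ) * z)) := by
  have := hasSum_geometric_of_norm_lt_one (UnitDisc.norm_conj_mul_lt_one w z)
  simpa [mul_pow, mul_comm] using this

theorem kernel_apply (w z : 𝔻) : kernel w z = 1 / (1 - conj (w : ℂ) * z) := by
  refine (hasSum_coeff (kernel w) z).unique ?_
  rw [coeff_kernel]
  simpa [kernelCoeff, mul_comm] using hasSum_kernel w z

/-- The reproducing property. -/
theorem inner_kernel (w : 𝔻) (f : HardySpace) : ⟪kernel w, f⟫_ℂ = f w := by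
  rw [inner_def, coeff_kernel]
  refine (lp.hasSum_inner _ _).unique ?_
  simpa [kernelCoeff] using hasSum_coeff f w

theorem inner_kernel_kernel (z w : 𝔻) :
    ⟪kernel z, kernel w⟫_ℂ = 1 / (1 - conj (w : ℂ) * z) := by
  rw [inner_kernel, kernel_apply]

theorem inner_kernel_right (w : 𝔻) (f : HardySpace) : ⟪f, kernel w⟫_ℂ = conj (f w) := by
  rw [← inner_conj_symm, inner_kernel]

/-- A function orthogonal to every kernel vanishes at every point, by the reproducing property. -/
theorem denseRange_linearCombination_kernel :
    DenseRange (Finsupp.linearCombination ℂ kernel) := by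
  have : Dense ((LinearMap.range (Finsupp.linearCombination ℂ kernel) :
      Submodule ℂ HardySpace) : Set HardySpace) := by
    rw [Submodule.dense_iff_topologicalClosure_eq_top, Submodule.topologicalClosure_eq_top_iff,
      Submodule.eq_bot_iff]
    intro f hf
    ext z
    rw [← inner_kernel, (Submodule.mem_orthogonal _ _).1 hf]
    · rfl
    · exact ⟨Finsupp.single z 1, by simp⟩
  rwa [LinearMap.coe_range] at this

theorem coeff_J (f : HardySpace) (n : ℕ) : (J f).coeff n = conj (f.coeff n) := by
  have h : ∀ z : 𝔻, HasSum (fun n => conj (f.coeff n) * (z : ℂ) ^ n) (J f z) := fun z => by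
    simpa using Complex.hasSum_conj'.2 (f.hasSum_coeff (star z))
  exact congrFun (taylorCoeff_unique (J f).hasSum_coeff h) n

theorem inner_J_J (f g : HardySpace) : ⟪J f, J g⟫_ℂ = ⟪g, f⟫_ℂ := by
  rw [inner_def, inner_def]
  refine (lp.hasSum_inner _ _).unique ?_
  refine (lp.hasSum_inner g.coeff f.coeff).congr_fun fun n => ?_
  simp [coeff_J, mul_comm]

end HardySpace

/-! ### Positive kernels -/

/-- A kernel `k` is positive if all its finite quadratic forms have nonnegative real part. -/
def IsPosKernel {X : Type*} (k : X → X → ℂ) : Prop :=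
  ∀ c : X →₀ ℂ, 0 ≤ (∑ z ∈ c.support, ∑ w ∈ c.support, conj (c z) * c w * k z w).re

section PosKernel

variable {X H : Type*} [NormedAddCommGroup H] [InnerProductSpace ℂ H]

theorem norm_linearCombination_sq (v : X → H) (c : X →₀ ℂ) :
    ‖Finsupp.linearCombination ℂ v c‖ ^ 2 =
      (∑ z ∈ c.support, ∑ w ∈ c.support, conj (c z) * c w * ⟪v z, v w⟫_ℂ).re := by
  have h := norm_sq_eq_re_inner (𝕜 := ℂ) (Finsupp.linearCombination ℂ v c)
  rw [h, Finsupp.linearCombination_apply, Finsupp.sum, sum_inner]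
  simp only [inner_sum, inner_smul_left, inner_smul_right, mul_assoc, RCLike.re_to_complex]
  congr 1
  refine Finset.sum_congr rfl fun z _ => Finset.sum_congr rfl fun w _ => ?_
  ring

theorem isPosKernel_inner (v : X → H) : IsPosKernel fun z w => ⟪v z, v w⟫_ℂ := fun c => by
  rw [← norm_linearCombination_sq]
  positivity

theorem IsPosKernel.add {k l : X → X → ℂ} (hk : IsPosKernel k) (hl : IsPosKernel l) :
    IsPosKernel fun z w => k z w + l z w := fun c => by
  simpa [mul_add, Finset.sum_add_distrib] using add_nonneg (hk c) (hl c)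

theorem IsPosKernel.hasSum {k : ℕ → X → X → ℂ} {l : X → X → ℂ} (hk : ∀ n, IsPosKernel (k n))
    (h : ∀ z w, HasSum (fun n => k n z w) (l z w)) : IsPosKernel l := fun c =>
  (Complex.hasSum_re (hasSum_sum fun z _ => hasSum_sum fun w _ =>
    (h z w).mul_left (conj (c z) * c w))).nonneg fun n => hk n c

/-- This is what makes `u z ↦ v z` extend to a well-defined operator of norm at most `M` on the
closed span of the `u z`. -/
theorem norm_linearCombination_le {u v : X → H} {M : ℝ} (hM : 0 ≤ M)
    (h : IsPosKernel fun z w => (M : ℂ) ^ 2 * ⟪u z, u w⟫_ℂ - ⟪v z, v w⟫_ℂ) (c : X →₀ ℂ) :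
    ‖Finsupp.linearCombination ℂ v c‖ ≤ M * ‖Finsupp.linearCombination ℂ u c‖ := by
  refine le_of_sq_le_sq ?_ (by positivity)
  rw [mul_pow, norm_linearCombination_sq, norm_linearCombination_sq, ← Complex.re_ofReal_mul,
    ← sub_nonneg, ← Complex.sub_re, Finset.mul_sum, ← Finset.sum_sub_distrib]
  simp only [Finset.mul_sum, ← Finset.sum_sub_distrib]
  refine (h c).trans_eq ?_
  congr 1
  refine Finset.sum_congr rfl fun z _ => Finset.sum_congr rfl fun w _ => ?_
  push_cast
  ring

end PosKernel

open HardySpace in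
/-- A weighted composition operator is bounded as soon as the kernel expressing `W W* ≤ M²` is
positive. -/
theorem exists_isWeightedComposition {ψ : 𝔻 → ℂ} {φ : 𝔻 → 𝔻} {M : ℝ} (hM : 0 ≤ M)
    (h : IsPosKernel fun z w => (M : ℂ) ^ 2 * ⟪kernel z, kernel w⟫_ℂ -
      ⟪conj (ψ z) • kernel (φ z), conj (ψ w) • kernel (φ w)⟫_ℂ) :
    ∃ W : HardySpace →L[ℂ] HardySpace, IsWeightedComposition ψ φ W := by
  let e := Finsupp.linearCombination ℂ kernel
  let v := Finsupp.linearCombination ℂ fun z => conj (ψ z) • kernel (φ z)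
  -- `A` plays the role of the adjoint: it is prescribed on kernels by `K_z ↦ conj (ψ z) K_{φ z}`
  -- and extended by density. The operator sought is `A.adjoint`.
  let A : HardySpace →L[ℂ] HardySpace := v.extendOfNorm e
  have hA (z : 𝔻) : A (kernel z) = conj (ψ z) • kernel (φ z) := by
    have := LinearMap.extendOfNorm_eq (f := v) (e := e) denseRange_linearCombination_kernel
      ⟨M, norm_linearCombination_le hM h⟩ (Finsupp.single z 1)
    simpa [e, v] using this
  refine ⟨A.adjoint, fun f z => ?_⟩
  rw [← inner_kernel, ContinuousLinearMap.adjoint_inner_right, hA, inner_smul_left, inner_kernel,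
    conj_conj]

/-! ### The automorphism case -/

theorem Complex.UnitDisc.ofReal_sqrt_one_sub_sq (p : 𝔻) :
    ((Real.sqrt (1 - ‖(p : ℂ)‖ ^ 2) : ℝ) : ℂ) ^ 2 = 1 - p * conj (p : ℂ) := by
  rw [← ofReal_pow, Real.sq_sqrt (sub_nonneg.2 p.sq_norm_lt_one.le), Complex.mul_conj,
    Complex.normSq_eq_norm_sq]
  push_cast
  rfl

theorem Complex.UnitDisc.one_sub_mul_conj_ne_zero (w z : 𝔻) : 1 - (z : ℂ) * conj (w : ℂ) ≠ 0 := by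
  rw [mul_comm]
  exact w.one_sub_conj_mul_ne_zero z

theorem Circle.coe_mul_conj (u : Circle) : (u : ℂ) * conj (u : ℂ) = 1 := by
  rw [Complex.mul_conj, Circle.normSq_coe, ofReal_one]

open HardySpace

theorem one_sub_conj_tau_mul_tau (lam : Circle) (p z w : 𝔻) :
    1 - conj (tau lam p w : ℂ) * (tau lam p z : ℂ) =
      (1 - p * conj (p : ℂ)) * (1 - conj (w : ℂ) * z) /
        ((1 - p * conj (w : ℂ)) * (1 - conj (p : ℂ) * z)) := by
  have h1 := p.one_sub_conj_mul_ne_zero z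
  have h2 : 1 - (p : ℂ) * conj (w : ℂ) ≠ 0 := w.one_sub_mul_conj_ne_zero p
  simp only [tau, UnitDisc.coe_mk, map_div₀, map_mul, map_sub, map_one, conj_conj]
  rw [div_mul_div_comm, one_sub_div (mul_ne_zero h2 h1)]
  congr 1
  linear_combination (-(conj (p : ℂ) - conj (w : ℂ)) * (p - z)) * lam.coe_mul_conj

/-- This is `V V* = 1` read on kernels; it yields both the boundedness of `V` and, later, its
unitarity. -/
theorem inner_xi_kernel_tau (lam : Circle) (p z w : 𝔻) :
    ⟪conj (xi p z) • kernel (tau lam p z), conj (xi p w) • kernel (tau lam p w)⟫_ℂ =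
      ⟪kernel z, kernel w⟫_ℂ := by
  have h1 := p.one_sub_conj_mul_ne_zero z
  have h2 : 1 - (p : ℂ) * conj (w : ℂ) ≠ 0 := w.one_sub_mul_conj_ne_zero p
  have h3 := w.one_sub_conj_mul_ne_zero z
  have h4 : 1 - (p : ℂ) * conj (p : ℂ) ≠ 0 := p.one_sub_mul_conj_ne_zero p
  have hs := p.ofReal_sqrt_one_sub_sq
  rw [inner_smul_left, inner_smul_right, inner_kernel_kernel, inner_kernel_kernel, conj_conj,
    one_sub_conj_tau_mul_tau]
  simp only [xi, map_div₀, map_mul, map_sub, map_one, conj_conj, conj_ofReal]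
  generalize ((Real.sqrt (1 - ‖(p : ℂ)‖ ^ 2) : ℝ) : ℂ) = s at hs ⊢
  generalize 1 - conj (p : ℂ) * (z : ℂ) = x at *
  generalize 1 - (p : ℂ) * conj (w : ℂ) = y at *
  generalize 1 - conj (w : ℂ) * (z : ℂ) = u at *
  rw [← hs] at h4 ⊢
  have hs0 : s ≠ 0 := (pow_ne_zero_iff two_ne_zero).1 h4
  field_simp

theorem exists_isWeightedComposition_xi_tau (lam : Circle) (p : 𝔻) :
    ∃ V : HardySpace →L[ℂ] HardySpace, IsWeightedComposition (xi p) (tau lam p) V :=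
  exists_isWeightedComposition zero_le_one fun c => by
    simp only [inner_xi_kernel_tau, ofReal_one, one_pow, one_mul, sub_self, mul_zero,
      Finset.sum_const_zero, zero_re, le_refl]

/-! ### Linear fractional self-maps -/

/-- The first bound is the limit `r → 1`. If `α + γ ≤ 0`, the quadratic is convex: either its vertex
`y / (-γ)` lies in `[0, 1)`, where its value contradicts `hdet`, or the first bound forces `y = α =
-γ`, where `hdet` fails. -/
theorem quadratic_bounds {α γ y : ℝ} (hα : 0 < α)
    (h : ∀ r : ℝ, 0 ≤ r → r < 1 → 0 < α - 2 * y * r - γ * r ^ 2) (hy : 0 ≤ y)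
    (hdet : 0 < α * γ + y ^ 2) : 2 * y ≤ α - γ ∧ 0 < α + γ := by
  have h1 : 2 * y ≤ α - γ := by
    have ht : Filter.Tendsto (fun r : ℝ => α - 2 * y * r - γ * r ^ 2) (nhdsWithin 1 (Set.Iio 1))
        (nhds (α - 2 * y * 1 - γ * 1 ^ 2)) :=
      ((by fun_prop : Continuous fun r : ℝ => α - 2 * y * r - γ * r ^ 2).tendsto 1).mono_left
        nhdsWithin_le_nhds
    have := ge_of_tendsto ht (b := 0) <| by
      filter_upwards [Ioo_mem_nhdsLT (show (0 : ℝ) < 1 by norm_num)] with r hr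
      exact (h r hr.1.le hr.2).le
    linarith
  refine ⟨h1, ?_⟩
  by_contra! hneg
  obtain ⟨δ, rfl⟩ : ∃ δ, γ = -δ := ⟨-γ, (neg_neg γ).symm⟩
  have hδ : 0 < δ := by linarith
  by_cases hlt : y < δ
  · have h2 := h (y / δ) (by positivity) ((div_lt_one hδ).2 hlt)
    have h3 : α - 2 * y * (y / δ) - -δ * (y / δ) ^ 2 = (α * δ - y ^ 2) / δ := by
      field_simp
      ring
    rw [h3, div_pos_iff_of_pos_right hδ] at h2
    linarith
  · have : y = α := by linarith
    have : δ = α := by linarith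
    subst_vars
    nlinarith

namespace IsLinearFractionalSelfMap

variable {a b c d : ℂ}

theorem d_ne_zero (h : IsLinearFractionalSelfMap a b c d) : d ≠ 0 := by
  simpa using h.denom_ne_zero 0

theorem normSq_lt (h : IsLinearFractionalSelfMap a b c d) (z : 𝔻) :
    normSq (a * z + b) < normSq (c * z + d) := by
  have := h.norm_lt_one z
  rw [norm_div, div_lt_one (norm_pos_iff.2 (h.denom_ne_zero z))] at this
  rw [normSq_eq_norm_sq, normSq_eq_norm_sq]
  gcongr

/-- The hermitian form `|c z + d|² - |a z + b|²` of a linear fractional self-map of the disc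
exceeds a positive multiple of `1 - |z|²` by a sum of squares. -/
theorem exists_form_eq (h : IsLinearFractionalSelfMap a b c d) :
    ∃ (t r g : ℝ) (e : ℂ), 0 < t ∧ 0 ≤ r ∧ 0 ≤ g ∧ ∀ z w : ℂ,
      (c * z + d) * conj (c * w + d) - (a * z + b) * conj (a * w + b) =
        t * (1 - conj w * z) + r * ((1 + e * z) * conj (1 + e * w)) + g * (1 + z * conj w) := by
  -- `e` is the phase of the coefficient of `z` in the form, with the value `1` when that
  -- coefficient vanishes.
  obtain ⟨e, he, hY⟩ : ∃ e : ℂ, e * conj e = 1 ∧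
      c * conj d - a * conj b = (‖c * conj d - a * conj b‖ : ℂ) * e := by
    generalize c * conj d - a * conj b = Y
    by_cases hY : Y = 0
    · exact ⟨1, by simp, by simp [hY]⟩
    · have hn : (‖Y‖ : ℂ) ≠ 0 := by simpa using hY
      refine ⟨Y / ‖Y‖, ?_, by field_simp⟩
      rw [map_div₀, conj_ofReal, div_mul_div_comm, Complex.mul_conj, Complex.normSq_eq_norm_sq]
      push_cast
      field_simp
  set y := ‖c * conj d - a * conj b‖ with hy
  have hY' := congrArg conj hY
  simp only [map_sub, map_mul, conj_conj, conj_ofReal] at hY'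
  have hyn : 0 ≤ y := norm_nonneg _
  have hA := Complex.mul_conj a
  have hB := Complex.mul_conj b
  have hC := Complex.mul_conj c
  have hD := Complex.mul_conj d
  obtain ⟨h1, h2⟩ := quadratic_bounds (α := normSq d - normSq b) (γ := normSq a - normSq c) (y := y)
    (by simpa using h.normSq_lt 0)
    (fun r hr0 hr1 => by
      have he1 : ‖e‖ = 1 := by
        have := congrArg norm he
        rw [norm_mul, RCLike.norm_conj, norm_one] at this
        nlinarith [norm_nonneg e]
      -- On the circle of radius `r` this point makes the linear term of the form as negative as
      -- possible, namely `-2 y r`.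
      have := h.normSq_lt (UnitDisc.mk (-(r * conj e)) (by simpa [he1, abs_of_nonneg hr0] using hr1))
      rw [← sub_pos] at this
      refine this.trans_eq (ofReal_injective ?_)
      push_cast
      rw [← Complex.mul_conj, ← Complex.mul_conj, ← hA, ← hB, ← hC, ← hD]
      simp only [UnitDisc.coe_mk, map_add, map_neg, map_mul, conj_conj, conj_ofReal]
      linear_combination (-(r : ℂ) * conj e) * hY + (-(r : ℂ) * e) * hY' +
        (-2 * y * r + r ^ 2 * (c * conj c - a * conj a)) * he) hyn
    (by
      have hdet := normSq_pos.2 h.det_ne_zero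
      refine hdet.trans_eq (ofReal_injective ?_)
      push_cast
      rw [← Complex.mul_conj, ← hA, ← hB, ← hC, ← hD]
      have hy2 : (y : ℂ) ^ 2 =
          (c * conj d - a * conj b) * conj (c * conj d - a * conj b) := by
        rw [Complex.mul_conj, Complex.normSq_eq_norm_sq, ← hy]
        push_cast
        rfl
      rw [hy2]
      simp only [map_sub, map_mul, conj_conj]
      ring)
  -- With `α = |d|² - |b|²` and `γ = |a|² - |c|²`, matching coefficients gives `r = y`, `t + r + g =
  -- α` and `r + g - t = -γ`. The two bounds of `quadratic_bounds` are `g ≥ 0` and `t > 0`.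
  refine ⟨((normSq d - normSq b) + (normSq a - normSq c)) / 2, y,
    ((normSq d - normSq b) - (normSq a - normSq c)) / 2 - y, e, by linarith, hyn, by linarith,
    fun z w => ?_⟩
  push_cast
  rw [← hA, ← hB, ← hC, ← hD]
  simp only [map_add, map_mul, map_one]
  linear_combination z * hY + conj w * hY' - y * z * conj w * he

/-- The denominator of `1 / (1 - conj u * φ z)` has no zero in the closed disc. -/
theorem dual_norm_lt (h : IsLinearFractionalSelfMap a b c d) {e f : ℂ} (hef : ‖f‖ < ‖e‖) :
    ‖a * f - c * e‖ < ‖d * e - b * f‖ := by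
  obtain ⟨t, r, g, k, ht, hr, hg, H⟩ := h.exists_form_eq
  by_contra! hle
  have hf : a * f - c * e ≠ 0 := by
    intro h0
    rw [h0, norm_zero, norm_le_zero_iff] at hle
    have he : e = 0 := by
      refine (mul_eq_zero.1 ?_).resolve_left h.det_ne_zero
      linear_combination a * hle + b * h0
    rw [he, norm_zero] at hef
    exact (norm_nonneg _).not_gt hef
  -- This is the zero of the denominator, assumed to lie in the closed disc. There `e (c z + d) = f
  -- (a z + b)`, whereas `|a z + b| ≤ |c z + d|` and `|f| < |e|`. So both linear forms vanish at
  -- `z`, against the nonzero determinant.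
  set z := (d * e - b * f) / (a * f - c * e) with hzdef
  have hz : ‖z‖ ≤ 1 := by
    rw [hzdef, norm_div]
    exact div_le_one_of_le₀ hle (norm_nonneg _)
  have hz1 : e * (c * z + d) = f * (a * z + b) := by
    have hz2 : z * (a * f - c * e) = d * e - b * f := div_mul_cancel₀ _ hf
    linear_combination -hz2
  have hH : normSq (a * z + b) ≤ normSq (c * z + d) := by
    have hzz : normSq z ≤ 1 := by
      rw [normSq_eq_norm_sq]
      exact pow_le_one₀ (norm_nonneg _) hz
    have := H z z
    rw [mul_comm (conj z)] at this
    simp only [Complex.mul_conj] at this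
    norm_cast at this
    have h1 : 0 ≤ t * (1 - normSq z) := mul_nonneg ht.le (by linarith)
    have h2 := mul_nonneg hr (normSq_nonneg (1 + k * z))
    have h3 := mul_nonneg hg (by linarith [normSq_nonneg z] : 0 ≤ 1 + normSq z)
    linarith
  have hn := congrArg normSq hz1
  rw [normSq_mul, normSq_mul] at hn
  have hfe : normSq f < normSq e := by
    rw [normSq_eq_norm_sq, normSq_eq_norm_sq]
    gcongr
  have h0 : normSq (c * z + d) = 0 := by
    nlinarith [normSq_nonneg (c * z + d), normSq_nonneg f,
      mul_nonneg (normSq_nonneg f) (sub_nonneg.2 hH)]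
  have h1 : normSq (a * z + b) = 0 := le_antisymm (hH.trans_eq h0) (normSq_nonneg _)
  rw [normSq_eq_zero] at h0 h1
  refine h.det_ne_zero ?_
  by_cases ha : a = 0
  · rw [ha] at h1 ⊢
    linear_combination -c * h1
  · linear_combination a * h0 - c * h1

end IsLinearFractionalSelfMap

/-- The choice of `σ(0)` gives the weight the same denominator as the linear fractional map. -/
theorem kernelFun_sigmaFun {a b c d : ℂ} (h : IsLinearFractionalSelfMap a b c d) (z : 𝔻) :
    kernelFun (sigmaFun a b c d 0) z = d / (c * z + d) := by
  have h1 := h.denom_ne_zero z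
  have h2 := h.d_ne_zero
  simp only [kernelFun, sigmaFun, map_div₀, map_add, map_sub, map_neg, map_mul, conj_conj, map_zero]
  have h3 : 1 - (a * 0 - c) / (-b * 0 + d) * z = (c * z + d) / d := by
    rw [mul_zero, mul_zero, zero_sub, zero_add]
    field_simp
    ring
  rw [h3, one_div_div]

theorem inner_conj_smul_kernel_linFrac {a b c d : ℂ} (β : ℂ) (h : IsLinearFractionalSelfMap a b c d)
    (z w : 𝔻) :
    ⟪conj (β * (d / (c * z + d))) • kernel (linFrac h z),
      conj (β * (d / (c * w + d))) • kernel (linFrac h w)⟫_ℂ *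
      ((c * z + d) * conj (c * w + d) - (a * z + b) * conj (a * w + b)) =
      β * d * conj (β * d) := by
  have h0 := (linFrac h w).one_sub_conj_mul_ne_zero (linFrac h z)
  have h1 := h.denom_ne_zero z
  have h2 : conj (c * (w : ℂ) + d) ≠ 0 := (map_ne_zero conj).2 (h.denom_ne_zero w)
  rw [inner_smul_left, inner_smul_right, inner_kernel_kernel, conj_conj]
  have h3 : (c * z + d) * conj (c * w + d) - (a * z + b) * conj (a * w + b) =
      (c * z + d) * conj (c * (w : ℂ) + d) *
        (1 - conj (linFrac h w : ℂ) * (linFrac h z : ℂ)) := by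
    simp only [linFrac, UnitDisc.coe_mk]
    rw [map_div₀]
    field_simp
  rw [h3, map_mul, map_div₀, map_mul]
  field_simp

theorem exists_isWeightedComposition_linFrac {a b c d : ℂ} (β : ℂ)
    (h : IsLinearFractionalSelfMap a b c d) :
    ∃ W : HardySpace →L[ℂ] HardySpace,
      IsWeightedComposition (fun z => β * (d / (c * z + d))) (linFrac h) W := by
  obtain ⟨t, r, g, e, ht, hr, hg, H⟩ := h.exists_form_eq
  have hM : (0 : ℝ) ≤ ‖β * d‖ / Real.sqrt t := by positivity
  refine exists_isWeightedComposition hM ?_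
  have hM2 : ((‖β * d‖ / Real.sqrt t : ℝ) : ℂ) ^ 2 = β * d * conj (β * d) / t := by
    rw [Complex.mul_conj, Complex.normSq_eq_norm_sq, ← ofReal_pow, div_pow, Real.sq_sqrt ht.le]
    push_cast
    rfl
  let v (z : 𝔻) : HardySpace := conj (β * (d / (c * z + d))) • kernel (linFrac h z)
  have htc : (t : ℂ) ≠ 0 := ofReal_ne_zero.2 ht.ne'
  have key (q : ℂ → ℂ) (n : ℕ) (z w : 𝔻) :
      ⟪(conj (q z * (z : ℂ) ^ n)) • v z, (conj (q w * (w : ℂ) ^ n)) • v w⟫_ℂ =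
        q z * conj (q w) * ⟪v z, v w⟫_ℂ * ((z : ℂ) ^ n * conj (w : ℂ) ^ n) := by
    rw [inner_smul_left, inner_smul_right, conj_conj, map_mul, map_pow]
    ring
  have hpos (q : ℂ → ℂ) (n : ℕ) := isPosKernel_inner fun z : 𝔻 => (conj (q z * (z : ℂ) ^ n)) • v z
  simp only [key] at hpos
  have hr2 : ((Real.sqrt (r / t) : ℝ) : ℂ) * (Real.sqrt (r / t) : ℝ) = r / t := by
    rw [← ofReal_mul, Real.mul_self_sqrt (by positivity)]
    push_cast
    rfl
  have hg2 : ((Real.sqrt (g / t) : ℝ) : ℂ) * (Real.sqrt (g / t) : ℝ) = g / t := by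
    rw [← ofReal_mul, Real.mul_self_sqrt (by positivity)]
    push_cast
    rfl
  -- With `Q` the hermitian form and `x = 1 - conj w * z`, the difference of kernels is `⟪v z, v w⟫
  -- (Q - t x) / (t x)`. Expanding `1 / x` as a geometric series and `Q - t x` by `H` gives three
  -- positive kernels for each `n`; the term `g (1 + z conj w)` supplies two of them.
  refine IsPosKernel.hasSum (fun n =>
    ((hpos (fun z => Real.sqrt (r / t) * (1 + e * z)) n).add
      (hpos (fun _ => Real.sqrt (g / t)) n)).add (hpos (fun z => Real.sqrt (g / t) * z) n))
    fun z w => ?_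
  have hs := (hasSum_kernel w z).mul_left
    ((r * ((1 + e * z) * conj (1 + e * w)) + g * (1 + z * conj (w : ℂ))) / t * ⟪v z, v w⟫_ℂ)
  have hv := inner_conj_smul_kernel_linFrac β h z w
  rw [H] at hv
  change ⟪v z, v w⟫_ℂ * _ = _ at hv
  refine Eq.mp (congrArg₂ (fun k l => HasSum k l) (funext fun n => ?_) ?_) hs
  · simp only [map_mul, conj_ofReal]
    linear_combination
      (-(1 + e * z) * conj (1 + e * (w : ℂ)) * ⟪v z, v w⟫_ℂ * (z ^ n * conj (w : ℂ) ^ n)) * hr2 -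
      (1 + z * conj (w : ℂ)) * ⟪v z, v w⟫_ℂ * (z ^ n * conj (w : ℂ) ^ n) * hg2
  · rw [inner_kernel_kernel, hM2, ← hv]
    change _ = _ - ⟪v z, v w⟫_ℂ
    have h3 := w.one_sub_conj_mul_ne_zero z
    generalize 1 - conj (w : ℂ) * (z : ℂ) = x at *
    field_simp
    ring

/-! ### Adjoints of weighted composition operators -/

theorem IsWeightedComposition.adjoint_kernel {ψ : 𝔻 → ℂ} {φ : 𝔻 → 𝔻}
    {T : HardySpace →L[ℂ] HardySpace} (h : IsWeightedComposition ψ φ T) (w : 𝔻) :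
    T.adjoint (kernel w) = conj (ψ w) • kernel (φ w) := by
  ext z
  rw [← inner_kernel, ContinuousLinearMap.adjoint_inner_right, inner_kernel_right, h, map_mul,
    smul_apply, ← inner_kernel_right, inner_kernel]

/-! ### The conjugation -/

section Conjugation

variable {lam : Circle} {p : 𝔻} {V : HardySpace →L[ℂ] HardySpace}

theorem conj_circle_mul (hlam : (lam : ℂ) * p = conj (p : ℂ)) :
    conj (lam : ℂ) * conj (p : ℂ) = p := by
  simpa using congrArg conj hlam

theorem coe_star_tau_star (hlam : (lam : ℂ) * p = conj (p : ℂ)) (z : 𝔻) :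
    ((star (tau lam p (star z)) : 𝔻) : ℂ) = (p - conj (lam : ℂ) * z) / (1 - z * p) := by
  simp only [UnitDisc.coe_star, tau, UnitDisc.coe_mk, map_div₀, map_mul, map_sub, map_one,
    conj_conj, mul_sub, conj_circle_mul hlam, mul_comm (p : ℂ)]

theorem one_sub_mul_ne_zero (z w : 𝔻) : 1 - (z : ℂ) * w ≠ 0 := by
  simpa using (star z).one_sub_conj_mul_ne_zero w

theorem one_sub_conj_mul_star_tau_star (hlam : (lam : ℂ) * p = conj (p : ℂ)) (z : 𝔻) :
    1 - conj (p : ℂ) * ((star (tau lam p (star z)) : 𝔻) : ℂ) =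
      (1 - p * conj (p : ℂ)) / (1 - z * p) := by
  rw [coe_star_tau_star hlam, mul_div_assoc', one_sub_div (one_sub_mul_ne_zero z p)]
  congr 1
  linear_combination (z : ℂ) * conj_circle_mul hlam

/-- The condition `λ p = conj p` is what makes `z ↦ conj (τ (conj z))` inverse to `τ`; together with
the matching identity `xi_tau_star` for the weights it makes `J V` an involution. -/
theorem tau_star_tau_star (hlam : (lam : ℂ) * p = conj (p : ℂ)) (z : 𝔻) :
    tau lam p (star (tau lam p (star z))) = z := by
  refine UnitDisc.coe_injective ?_
  rw [tau, UnitDisc.coe_mk, one_sub_conj_mul_star_tau_star hlam, coe_star_tau_star hlam]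
  have h1 := one_sub_mul_ne_zero z p
  have h2 : 1 - (p : ℂ) * conj (p : ℂ) ≠ 0 := p.one_sub_mul_conj_ne_zero p
  rw [sub_div' h1, mul_div_assoc', div_div_div_cancel_right₀ h1, div_eq_iff h2]
  linear_combination (z : ℂ) * lam.coe_mul_conj - (z : ℂ) * p * hlam

theorem xi_tau_star (hlam : (lam : ℂ) * p = conj (p : ℂ)) (z : 𝔻) :
    conj (xi p (star z)) * xi p (star (tau lam p (star z))) = 1 := by
  have h1 := one_sub_mul_ne_zero z p
  have h2 : 1 - (p : ℂ) * conj (p : ℂ) ≠ 0 := p.one_sub_mul_conj_ne_zero p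
  rw [xi, xi, one_sub_conj_mul_star_tau_star hlam]
  simp only [UnitDisc.coe_star, map_div₀, map_mul, map_sub, map_one, conj_conj, conj_ofReal]
  rw [mul_comm (p : ℂ) z, div_div_eq_mul_div, div_mul_div_comm, div_eq_one_iff_eq (mul_ne_zero h1 h2),
    ← p.ofReal_sqrt_one_sub_sq]
  ring

theorem J_comp_apply (hV : IsWeightedComposition (xi p) (tau lam p) V) (f : HardySpace) (z : 𝔻) :
    J.comp (V : HardySpace →ₗ[ℂ] HardySpace) f z =
      conj (xi p (star z) * f (tau lam p (star z))) := by
  rw [← hV]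
  rfl

theorem J_comp_involutive (hlam : (lam : ℂ) * p = conj (p : ℂ))
    (hV : IsWeightedComposition (xi p) (tau lam p) V) (f : HardySpace) :
    J.comp (V : HardySpace →ₗ[ℂ] HardySpace) (J.comp (V : HardySpace →ₗ[ℂ] HardySpace) f) = f := by
  ext z
  rw [J_comp_apply hV, J_comp_apply hV, tau_star_tau_star hlam, map_mul, conj_conj, ← mul_assoc,
    xi_tau_star hlam, one_mul]

theorem IsWeightedComposition.xi_tau_comp_adjoint (hV : IsWeightedComposition (xi p) (tau lam p) V)
    (f : HardySpace) : V (V.adjoint f) = f := by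
  have h (w : 𝔻) : V (V.adjoint (kernel w)) = kernel w := by
    ext z
    rw [← inner_kernel, ← inner_kernel, ← ContinuousLinearMap.adjoint_inner_left,
      hV.adjoint_kernel, hV.adjoint_kernel, inner_xi_kernel_tau]
  ext z
  rw [← inner_kernel, ← ContinuousLinearMap.adjoint_inner_left,
    ContinuousLinearMap.adjoint_inner_right, h, inner_kernel]

theorem isConjugation_J_comp (hlam : (lam : ℂ) * p = conj (p : ℂ))
    (hV : IsWeightedComposition (xi p) (tau lam p) V) :
    IsConjugation (J.comp (V : HardySpace →ₗ[ℂ] HardySpace)) := by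
  have hinj : Function.Injective V := fun f g hfg => by
    rw [← J_comp_involutive hlam hV f, ← J_comp_involutive hlam hV g]
    simp [hfg]
  -- `V V* = 1` alone gives a coisometry; injectivity, which comes from the involution, upgrades `V
  -- V* V = V` to `V* V = 1`.
  have hVV (f : HardySpace) : V.adjoint (V f) = f := hinj (hV.xi_tau_comp_adjoint (V f))
  refine ⟨fun f g => ?_, J_comp_involutive hlam hV⟩
  change ⟪J (V f), J (V g)⟫_ℂ = _
  rw [inner_J_J, ← ContinuousLinearMap.adjoint_inner_right, hVV]

end Conjugation

/-- `C`-normality may be tested on reproducing kernels. -/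
theorem isCNormal_iff_kernel {C : HardySpace →ₗ⋆[ℂ] HardySpace} (hC : IsConjugation C)
    (T : HardySpace →L[ℂ] HardySpace) :
    IsCNormal C T ↔ ∀ w z : 𝔻,
      C (T.adjoint (T (C (kernel w)))) z = T (T.adjoint (kernel w)) z := by
  refine ⟨fun h w z => by rw [h], fun h f => ?_⟩
  have h1 (x y : HardySpace) : ⟪x, C y⟫_ℂ = ⟪y, C x⟫_ℂ := by
    rw [← hC.1 (C x), hC.2]
  have h2 (x y : HardySpace) : ⟪C x, y⟫_ℂ = ⟪C y, x⟫_ℂ := by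
    rw [← hC.1 x, hC.2]
  ext z
  have hz : C (T.adjoint (T (C (kernel z)))) = T (T.adjoint (kernel z)) := HardySpace.ext (h z)
  -- Self-adjointness of both sides moves each operator from `f` onto the kernel at `z`, so no
  -- density argument is needed.
  rw [← inner_kernel, ← inner_kernel, h1, ContinuousLinearMap.adjoint_inner_left,
    ← ContinuousLinearMap.adjoint_inner_right, h2, hz, ← ContinuousLinearMap.adjoint_inner_right,
    ContinuousLinearMap.adjoint_inner_left]

/-! ### Linear fractional vectors -/

/-- The function `z ↦ 1 / (e - f z)` for `|f| < |e|`, as an element of `H²`. -/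
def fracVec {e f : ℂ} (h : ‖f‖ < ‖e‖) : HardySpace :=
  e⁻¹ • kernel (UnitDisc.mk (conj (f / e)) (by
    rw [RCLike.norm_conj, norm_div, div_lt_one ((norm_nonneg f).trans_lt h)]
    exact h))

theorem ne_zero_of_norm_lt {e f : ℂ} (h : ‖f‖ < ‖e‖) : e ≠ 0 :=
  norm_pos_iff.1 ((norm_nonneg f).trans_lt h)

theorem fracVec_apply {e f : ℂ} (h : ‖f‖ < ‖e‖) (z : 𝔻) : fracVec h z = 1 / (e - f * z) := by
  have he := ne_zero_of_norm_lt h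
  rw [fracVec, smul_apply, kernel_apply, UnitDisc.coe_mk, conj_conj]
  have : e - f * z = e * (1 - f / e * z) := by field_simp
  rw [this, one_div, one_div, mul_inv]

/-- With `x` the common denominator of weight and map, this is why weighted composition preserves
the functions `1 / (e - f z)`. -/
theorem div_mul_one_div_sub {x : ℂ} (hx : x ≠ 0) (n e f m : ℂ) :
    n / x * (1 / (e - f * (m / x))) = n / (e * x - f * m) := by
  have : e - f * (m / x) = (e * x - f * m) / x := by field_simp
  rw [this, one_div_div, div_mul_div_cancel₀ hx]

section LinearFractional

variable {a b c d β : ℂ} {h : IsLinearFractionalSelfMap a b c d} {T : HardySpace →L[ℂ] HardySpace}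

theorem IsWeightedComposition.apply_linFrac
    (hT : IsWeightedComposition (fun z => β * (d / (c * z + d))) (linFrac h) T) (f : HardySpace)
    (z : 𝔻) : T f z = β * d / (c * z + d) * f (linFrac h z) := by
  rw [hT, mul_div_assoc]

theorem IsWeightedComposition.apply_fracVec
    (hT : IsWeightedComposition (fun z => β * (d / (c * z + d))) (linFrac h) T)
    {e f : ℂ} (hef : ‖f‖ < ‖e‖) :
    T (fracVec hef) = (β * d) • fracVec (h.dual_norm_lt hef) := by
  ext z
  rw [hT.apply_linFrac, fracVec_apply, smul_apply, fracVec_apply, linFrac, UnitDisc.coe_mk,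
    div_mul_one_div_sub (h.denom_ne_zero z), mul_one_div]
  congr 1
  ring

/-- Follows from `(T* K_u)(z) = conj ((T K_z)(u))`. A pointwise formula is enough, as only `C`
remains to be applied, and that is evaluated pointwise. -/
theorem IsWeightedComposition.adjoint_fracVec
    (hT : IsWeightedComposition (fun z => β * (d / (c * z + d))) (linFrac h) T)
    {e f : ℂ} (hef : ‖f‖ < ‖e‖) (z : 𝔻) :
    T.adjoint (fracVec hef) z =
      conj (β * d) / ((conj d * e + conj c * f) - (conj b * e + conj a * f) * z) := by
  have he := ne_zero_of_norm_lt hef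
  obtain ⟨u, hu, hv⟩ : ∃ u : 𝔻, (u : ℂ) = conj (f / e) ∧ fracVec hef = e⁻¹ • kernel u :=
    ⟨_, UnitDisc.coe_mk _ _, rfl⟩
  rw [← inner_kernel, ContinuousLinearMap.adjoint_inner_right, hv, inner_smul_right,
    inner_kernel_right, hT.apply_linFrac, kernel_apply, linFrac, UnitDisc.coe_mk,
    div_mul_one_div_sub (h.denom_ne_zero _), hu]
  simp only [map_div₀, map_mul, map_sub, map_add, conj_conj, map_one]
  rw [inv_mul_eq_div, div_div]
  congr 1
  field_simp
  ring

theorem IsWeightedComposition.inner_comp_adjoint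
    (hT : IsWeightedComposition (fun z => β * (d / (c * z + d))) (linFrac h) T) (z w : 𝔻) :
    T (T.adjoint (kernel w)) z *
      ((c * z + d) * conj (c * w + d) - (a * z + b) * conj (a * w + b)) =
      β * d * conj (β * d) := by
  rw [← inner_kernel, ← ContinuousLinearMap.adjoint_inner_left, hT.adjoint_kernel,
    hT.adjoint_kernel, inner_conj_smul_kernel_linFrac]

variable {lam : Circle} {p : 𝔻} {V : HardySpace →L[ℂ] HardySpace}

theorem norm_sub_conj_circle_mul_lt (hlam : (lam : ℂ) * p = conj (p : ℂ)) (w : 𝔻) :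
    ‖(p : ℂ) - conj (lam : ℂ) * w‖ < ‖1 - (w : ℂ) * p‖ := by
  have := (star (tau lam p (star w))).norm_lt_one
  rwa [coe_star_tau_star hlam, norm_div, div_lt_one (norm_pos_iff.2 (one_sub_mul_ne_zero w p))]
    at this

theorem J_comp_kernel (hlam : (lam : ℂ) * p = conj (p : ℂ))
    (hV : IsWeightedComposition (xi p) (tau lam p) V) (w : 𝔻) :
    J.comp (V : HardySpace →ₗ[ℂ] HardySpace) (kernel w) =
      (Real.sqrt (1 - ‖(p : ℂ)‖ ^ 2) : ℂ) • fracVec (norm_sub_conj_circle_mul_lt hlam w) := by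
  ext z
  rw [J_comp_apply hV, kernel_apply, xi, tau, UnitDisc.coe_mk,
    div_mul_one_div_sub (p.one_sub_conj_mul_ne_zero _), smul_apply, fracVec_apply, mul_one_div]
  simp only [UnitDisc.coe_star, map_div₀, map_mul, map_sub, map_one, conj_conj, conj_ofReal]
  congr 1
  linear_combination (-(w : ℂ)) * conj_circle_mul hlam

theorem J_comp_adjoint_comp_kernel (hlam : (lam : ℂ) * p = conj (p : ℂ))
    (hV : IsWeightedComposition (xi p) (tau lam p) V)
    (hT : IsWeightedComposition (fun z => β * (d / (c * z + d))) (linFrac h) T) (z w : 𝔻) :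
    J.comp (V : HardySpace →ₗ[ℂ] HardySpace)
        (T.adjoint (T (J.comp (V : HardySpace →ₗ[ℂ] HardySpace) (kernel w)))) z =
      (1 - p * conj (p : ℂ)) * (β * d * conj (β * d)) /
        ((d * (conj d * (1 - conj (w : ℂ) * conj (p : ℂ)) -
              conj b * (conj (p : ℂ) - lam * conj (w : ℂ))) +
            c * (conj a * (conj (p : ℂ) - lam * conj (w : ℂ)) -
              conj c * (1 - conj (w : ℂ) * conj (p : ℂ)))) * (1 - p * z) -
          (b * (conj d * (1 - conj (w : ℂ) * conj (p : ℂ)) -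
              conj b * (conj (p : ℂ) - lam * conj (w : ℂ))) +
            a * (conj a * (conj (p : ℂ) - lam * conj (w : ℂ)) -
              conj c * (1 - conj (w : ℂ) * conj (p : ℂ)))) *
            (conj (lam : ℂ) * (conj (p : ℂ) - z))) := by
  -- Regrouping brings the weight `s / x` of the outer `V` next to `1 / X`, so that
  -- `div_mul_one_div_sub` applies; the two factors `s` combine to `1 - |p|²`.
  have hX (X : ℂ) (s k l x : ℂ) : s / x * (s * (k * (l / X))) = s / x * (1 / X) * (s * (k * l)) := by
    ring
  rw [J_comp_kernel hlam hV, map_smul T, hT.apply_fracVec, map_smul T.adjoint,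
    map_smul T.adjoint, J_comp_apply hV,
    smul_apply, smul_apply, hT.adjoint_fracVec, xi, tau, UnitDisc.coe_mk, hX,
    div_mul_one_div_sub (p.one_sub_conj_mul_ne_zero _), ← p.ofReal_sqrt_one_sub_sq]
  simp only [UnitDisc.coe_star, map_div₀, map_mul, map_sub, map_add, map_one, conj_conj,
    conj_ofReal, div_mul_eq_mul_div]
  congr 1
  ring

end LinearFractional

/-! ### Comparison of the kernels -/

section Comparison

variable {lam : Circle} {p : 𝔻}

/-- Both sides have degree at most one in `z` and in `conj w`, so four coefficients are compared.
Those of `z` and `conj w` are conjugate relations, and those of `1` and `z conj w` reduce to the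
same relation by `|λ| = 1` and `λ p = conj p`. -/
theorem kernel_identity_iff (hp : p ≠ 0) (hlam : (lam : ℂ) * p = conj (p : ℂ)) (a b c d : ℂ) :
    (∀ w z : 𝔻,
      (d * (conj d * (1 - conj (w : ℂ) * conj (p : ℂ)) -
              conj b * (conj (p : ℂ) - lam * conj (w : ℂ))) +
            c * (conj a * (conj (p : ℂ) - lam * conj (w : ℂ)) -
              conj c * (1 - conj (w : ℂ) * conj (p : ℂ)))) * (1 - p * z) -
          (b * (conj d * (1 - conj (w : ℂ) * conj (p : ℂ)) -
              conj b * (conj (p : ℂ) - lam * conj (w : ℂ))) +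
            a * (conj a * (conj (p : ℂ) - lam * conj (w : ℂ)) -
              conj c * (1 - conj (w : ℂ) * conj (p : ℂ)))) *
            (conj (lam : ℂ) * (conj (p : ℂ) - z)) =
        (1 - p * conj (p : ℂ)) *
          ((c * z + d) * conj (c * w + d) - (a * z + b) * conj (a * w + b))) ↔
      (b * conj b - c * conj c) * p =
          (-(conj a * c) + conj b * d - a * conj b + c * conj d) * (p * conj (p : ℂ)) ∧
        (a * conj a - d * conj d) * (p * conj (p : ℂ)) =
          (conj a * c - conj b * d) * conj (p : ℂ) - (conj a * b - conj c * d) * p := by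
  have hp0 : (p : ℂ) ≠ 0 := UnitDisc.coe_eq_zero.not.2 hp
  have hp1 : conj (p : ℂ) ≠ 0 := (map_ne_zero conj).2 hp0
  have hP : 1 - (p : ℂ) * conj (p : ℂ) ≠ 0 := p.one_sub_mul_conj_ne_zero p
  have hl := lam.coe_mul_conj
  have hlam' := conj_circle_mul hlam
  constructor
  · intro H
    -- At `w = 0` the identity is affine in `z`, so the points `0` and `p ≠ 0` determine it: `e0` is
    -- the constant coefficient, `ez` that of `z`.
    have e0 := H 0 0
    have ep := H 0 p
    simp only [UnitDisc.coe_zero, map_zero, mul_zero, zero_mul, sub_zero, zero_add] at e0 ep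
    have ez : -p * (d * (conj d - conj b * conj (p : ℂ)) + c * (conj a * conj (p : ℂ) - conj c)) +
        conj (lam : ℂ) * (b * (conj d - conj b * conj (p : ℂ)) +
          a * (conj a * conj (p : ℂ) - conj c)) =
        (1 - p * conj (p : ℂ)) * (c * conj d - a * conj b) :=
      mul_left_cancel₀ hp0 (by linear_combination ep - e0)
    -- Adding `conj p` times `ez` to `e0` eliminates `λ` and leaves a common factor `1 - |p|²`.
    have s1 : b * conj b - c * conj c =
        (-(conj a * c) + conj b * d - a * conj b + c * conj d) * conj (p : ℂ) := by
      refine mul_left_cancel₀ hP ?_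
      linear_combination e0 + conj (p : ℂ) * ez
    have s1' := congrArg conj s1
    simp only [map_add, map_sub, map_neg, map_mul, conj_conj] at s1'
    refine ⟨by linear_combination p * s1, ?_⟩
    linear_combination s1' - e0 -
      (b * (conj d - conj b * conj (p : ℂ)) + a * (conj a * conj (p : ℂ) - conj c)) * hlam'
  · rintro ⟨s1, s2⟩ w z
    replace s1 : b * conj b - c * conj c =
        (-(conj a * c) + conj b * d - a * conj b + c * conj d) * conj (p : ℂ) :=
      mul_right_cancel₀ hp0 (by linear_combination s1)
    have s1' := congrArg conj s1
    simp only [map_add, map_sub, map_neg, map_mul, conj_conj] at s1'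
    have ez : -p * (d * (conj d - conj b * conj (p : ℂ)) + c * (conj a * conj (p : ℂ) - conj c)) +
        conj (lam : ℂ) * (b * (conj d - conj b * conj (p : ℂ)) +
          a * (conj a * conj (p : ℂ) - conj c)) =
        (1 - p * conj (p : ℂ)) * (c * conj d - a * conj b) := by
      refine mul_left_cancel₀ hp1 ?_
      linear_combination (1 - p * conj (p : ℂ)) * s1 + s2 - s1' +
        (b * (conj d - conj b * conj (p : ℂ)) + a * (conj a * conj (p : ℂ) - conj c)) * hlam'
    have ew := congrArg conj ez
    simp only [map_add, map_sub, map_neg, map_mul, map_one, conj_conj] at ew ⊢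
    linear_combination (1 + z * conj (w : ℂ)) * (s1' - s2) -
      (b * (conj d - conj b * conj (p : ℂ)) + a * (conj a * conj (p : ℂ) - conj c)) * hlam' +
      z * ez + conj (w : ℂ) * ew -
      conj (w : ℂ) * (b * (conj b * lam - conj d * conj (p : ℂ)) +
        a * (conj c * conj (p : ℂ) - conj a * lam)) * hlam' +
      z * conj (w : ℂ) * ((a * conj c - b * conj d) * hlam' + (b * conj b - a * conj a) * hl +
        (c * conj a - d * conj b) * hlam)

end Comparison

theorem mainTheorem5 (p : 𝔻) (hp : p ≠ 0) (lam : Circle) (hlam : (lam : ℂ) * p = conj (p : ℂ))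
    (a b c d β : ℂ) (hφ : IsLinearFractionalSelfMap a b c d) (hβ : β ≠ 0) :
    (∃ W : HardySpace →L[ℂ] HardySpace,
      IsWeightedComposition (fun z => β * kernelFun (sigmaFun a b c d 0) z) (linFrac hφ) W) ∧
    (∃ V : HardySpace →L[ℂ] HardySpace, IsWeightedComposition (xi p) (tau lam p) V) ∧
    ∀ W V : HardySpace →L[ℂ] HardySpace,
      IsWeightedComposition (fun z => β * kernelFun (sigmaFun a b c d 0) z) (linFrac hφ) W →
      IsWeightedComposition (xi p) (tau lam p) V →
      IsConjugation (HardySpace.J.comp (V : HardySpace →ₗ[ℂ] HardySpace)) ∧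
      (IsCNormal (HardySpace.J.comp (V : HardySpace →ₗ[ℂ] HardySpace)) W ↔
        ((‖b‖ ^ 2 - ‖c‖ ^ 2 : ℝ) : ℂ) * p =
            (-(conj a * c) + conj b * d - a * conj b + c * conj d) * ((‖(p : ℂ)‖ ^ 2 : ℝ) : ℂ) ∧
          ((‖a‖ ^ 2 - ‖d‖ ^ 2 : ℝ) : ℂ) * ((‖(p : ℂ)‖ ^ 2 : ℝ) : ℂ) =
            (conj a * c - conj b * d) * conj (p : ℂ) - (conj a * b - conj c * d) * p) := by
  simp only [kernelFun_sigmaFun hφ]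
  refine ⟨exists_isWeightedComposition_linFrac β hφ, exists_isWeightedComposition_xi_tau lam p,
    fun W V hW hV => ⟨isConjugation_J_comp hlam hV, ?_⟩⟩
  have hN : β * d * conj (β * d) ≠ 0 :=
    mul_ne_zero (mul_ne_zero hβ hφ.d_ne_zero)
      ((map_ne_zero conj).2 (mul_ne_zero hβ hφ.d_ne_zero))
  have hP : 1 - (p : ℂ) * conj (p : ℂ) ≠ 0 := p.one_sub_mul_conj_ne_zero p
  simp only [ofReal_sub, ← normSq_eq_norm_sq, ← Complex.mul_conj]
  rw [← kernel_identity_iff hp hlam, isCNormal_iff_kernel (isConjugation_J_comp hlam hV)]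
  refine forall₂_congr fun w z => ?_
  rw [J_comp_adjoint_comp_kernel hlam hV hW]
  have hH := hW.inner_comp_adjoint z w
  generalize W (W.adjoint (kernel w)) z = x at hH ⊢
  generalize (c * (z : ℂ) + d) * conj (c * (w : ℂ) + d) -
    (a * z + b) * conj (a * (w : ℂ) + b) = y at hH ⊢
  -- The product `x * y` is the nonzero constant `|β d|²`, so equality of the two values is equality
  -- of their denominators.
  have hx : x ≠ 0 := left_ne_zero_of_mul (hH.trans_ne hN)
  have hy : y ≠ 0 := right_ne_zero_of_mul (hH.trans_ne hN)
  rw [← hH]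
  constructor
  · intro hG
    -- The denominator on the left is nonzero because the quotient equals `x ≠ 0`, while division by
    -- zero would give `0`.
    rw [div_eq_iff (div_ne_zero_iff.1 (hG.trans_ne hx)).2] at hG
    exact mul_left_cancel₀ hx (by rw [← hG]; ring)
  · intro hG
    rw [hG, div_eq_iff (mul_ne_zero hP hy)]
    ring

end
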